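/- Let $a>0$, $m\in\mathbb{Z}$, $n\in\mathbb{N}=\{1,2,\dots\}$, and let $\xi\in L^2(\mathbb{B}_a^2)$ be complex valued, where $\mathbb{B}_a^2=\{\mathbf{x}\in\mathbb{R}^2:\|\mathbf{x}\|_2\le a\}$; write $\xi(r,\theta)=\xi(r\cos\theta,r\sin\theta)$. Let $J_m$ be the Bessel function of the first kind of order $m$ (so $J_{-m}=(-1)^mJ_m$), let $z_{nm}$ be its $n$-th positive zero, $\rho_{nm}=z_{nm}/a$, $N_n^{(m)}(a)=\frac{a^2}{2}J_m'(z_{nm})^2$, and $$\Psi_{nm}^a(r,\theta)=\frac{1}{\sqrt{N_n^{(m)}(a)}}\,J_m(\rho_{nm}r)\,\frac{1}{\sqrt{2\pi}}\,e^{\mathrm{i}m\theta},\qquad C_{n,m}^a(\xi)=\int_0^a\int_0^{2\pi}\xi(r,\theta)\,\overline{\Psi_{nm}^a(r,\theta)}\,r\,d\theta\,dr .$$ For $\mathbf{k}=(k_1,k_2)\in\mathbb{Z}^2$ let $|\mathbf{k}|=\sqrt{k_1^2+k_2^2}$, let $\Phi(\mathbf{k})\in[0,2\pi)$ be the polar angle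 of $\mathbf{k}$ (with $\Phi(0)=0$), and put $$\widehat{\xi}\{\mathbf{k}\}=\int_0^a\int_0^{2\pi}\xi(r,\theta)\,e^{-\pi\mathrm{i}a^{-1}r(k_1\cos\theta+k_2\sin\theta)}\,r\,d\theta\,dr,$$ $$c_a(\mathbf{k};n,m)=\sqrt{\pi}\,(-1)^n\,\mathrm{i}^{|m|}\,\rho_{nm}\,\frac{J_m(\pi|\mathbf{k}|)\,e^{-\mathrm{i}m\Phi(\mathbf{k})}}{2\,(\pi^2|\mathbf{k}|^2-z_{nm}^2)},$$ where, if $\pi|\mathbf{k}|=z_{nm}$ for some $\mathbf{k}$, the quotient $J_m(x)/(x^2-z_{nm}^2)$ at $x=\pi|\mathbf{k}|$ is understood as its limit $J_m'(z_{nm})/(2z_{nm})$. Then $\widehat{\xi}\{\mathbf{k}\}$ is the Fourier coefficient over the square of the extension $E(\xi)$ of $\xi$ by zero, $$\widehat{\xi}\{\mathbf{k}\}=\int_{[-a,a]^2}E(\xi)(\mathbf{x})\,e^{-\pi\mathrm{i}a^{-1}(k_1x_1+k_2x_2)}\,d\mathbf{x}\qquad\text{for all }\mathbf{k}\in\mathbb{Z}^2,$$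 and $$C_{n,m}^a(\xi)=\sum_{\mathbf{k}\in\mathbb{Z}^2}c_a(\mathbf{k};n,m)\,\widehat{\xi}\{\mathbf{k}\},$$ the series converging unconditionally. -/

import Mathlib

noncomputable section

namespace FourierBessel

/-- Bessel function of the first kind of integer order `m`, by Bessel's integral
`J_m(x) = (1/π) ∫_0^π cos (m τ - x sin τ) dτ`; in particular `J_{-m} = (-1)^m J_m`. -/
def besselJ (m : ℤ) (x : ℝ) : ℝ :=
  (1 / Real.pi) * ∫ τ in (0 : ℝ)..Real.pi, Real.cos (m * τ - x * Real.sin τ)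

/-- The `n`-th positive zero `z_{nm}` of `J_m` (`n = 1, 2, …`): the positive zero `x` of `J_m` such
that `J_m` has exactly `n - 1` zeros in `(0, x)`. -/
def besselZero (m : ℤ) (n : ℕ) : ℝ :=
  sInf {x : ℝ | 0 < x ∧ besselJ m x = 0 ∧
    Set.encard {y : ℝ | 0 < y ∧ y < x ∧ besselJ m y = 0} + 1 = (n : ℕ∞)}

/-- `ρ_{nm} = z_{nm} / a`. -/
def radialFreq (a : ℝ) (n : ℕ) (m : ℤ) : ℝ := besselZero m n / a

/-- The normalization constant `N_n^{(m)}(a) = (a² / 2) J_m'(z_{nm})²`. -/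
def normConst (a : ℝ) (n : ℕ) (m : ℤ) : ℝ :=
  a ^ 2 / 2 * (deriv (besselJ m) (besselZero m n)) ^ 2

/-- The zero-value-boundary basis function in polar coordinates,
`Ψ^a_{nm}(r, θ) = N_n^{(m)}(a)^{-1/2} J_m(ρ_{nm} r) (2π)^{-1/2} e^{imθ}`. -/
def basisFn (a : ℝ) (n : ℕ) (m : ℤ) (r θ : ℝ) : ℂ :=
  ((1 / Real.sqrt (normConst a n m) * besselJ m (radialFreq a n m * r) : ℝ) : ℂ) *
    (((1 / Real.sqrt (2 * Real.pi) : ℝ) : ℂ) * Complex.exp (Complex.I * m * θ))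

/-- The point `r u_θ = (r cos θ, r sin θ)` of the plane. -/
def polarPoint (r θ : ℝ) : EuclideanSpace ℝ (Fin 2) := !₂[r * Real.cos θ, r * Real.sin θ]

/-- The Fourier-Bessel coefficient
`C^a_{n,m}(ξ) = ∫_0^a ∫_0^{2π} ξ(r, θ) conj (Ψ^a_{nm}(r, θ)) r dr dθ`. -/
def diskCoeff (a : ℝ) (ξ : EuclideanSpace ℝ (Fin 2) → ℂ) (n : ℕ) (m : ℤ) : ℂ :=
  ∫ r in (0 : ℝ)..a, ∫ θ in (0 : ℝ)..(2 * Real.pi),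
    ξ (polarPoint r θ) * (starRingEnd ℂ) (basisFn a n m r θ) * (r : ℂ)

/-- The standard Fourier coefficient
`ξ^{k} = ∫_0^a ∫_0^{2π} ξ(r, θ) e^{-π i a⁻¹ r (k₁ cos θ + k₂ sin θ)} r dr dθ`. -/
def diskFourier (a : ℝ) (ξ : EuclideanSpace ℝ (Fin 2) → ℂ) (k : Fin 2 → ℤ) : ℂ :=
  ∫ r in (0 : ℝ)..a, ∫ θ in (0 : ℝ)..(2 * Real.pi),
    ξ (polarPoint r θ) *
      Complex.exp (-Complex.I *
        ((Real.pi / a * r * (k 0 * Real.cos θ + k 1 * Real.sin θ) : ℝ) : ℂ)) * (r : ℂ)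

/-- The canonical extension of `ξ` from the closed disk of radius `a` to the plane by zero. -/
def zeroPad (a : ℝ) (ξ : EuclideanSpace ℝ (Fin 2) → ℂ) : EuclideanSpace ℝ (Fin 2) → ℂ :=
  Set.indicator (Metric.closedBall 0 a) ξ

/-- The `k`-th Fourier coefficient over the square `[-a, a]²`,
`∫_{[-a,a]²} u(x) e^{-π i a⁻¹ (k₁ x₁ + k₂ x₂)} dx`. -/
def squareFourier (a : ℝ) (u : EuclideanSpace ℝ (Fin 2) → ℂ) (k : Fin 2 → ℤ) : ℂ :=
  ∫ x in {x : EuclideanSpace ℝ (Fin 2) | ∀ i, x i ∈ Set.Icc (-a) a},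
    u x * Complex.exp (-Complex.I * ((Real.pi / a * (k 0 * x 0 + k 1 * x 1) : ℝ) : ℂ))

/-- The Euclidean length `|k|`. -/
def latticeNorm (k : Fin 2 → ℤ) : ℝ := Real.sqrt ((k 0 : ℝ) ^ 2 + (k 1 : ℝ) ^ 2)

/-- The polar angle `Φ(k) ∈ [0, 2π)` of `k` (with `Φ(0) = 0`). -/
def latticeAngle (k : Fin 2 → ℤ) : ℝ :=
  toIcoMod Real.two_pi_pos 0 (Complex.arg ⟨(k 0 : ℝ), (k 1 : ℝ)⟩)

/-- The function `x ↦ J_m(x) / (x² - z_{nm}²)`, with its limit `J_m'(z_{nm}) / (2 z_{nm})`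
at the removable singularity `x = z_{nm}`. -/
def besselQuot (n : ℕ) (m : ℤ) (x : ℝ) : ℝ :=
  if x = besselZero m n then deriv (besselJ m) (besselZero m n) / (2 * besselZero m n)
  else besselJ m x / (x ^ 2 - besselZero m n ^ 2)

/-- The kernel `c_a(k; n, m) = √π (-1)^n i^{|m|} ρ_{nm} J_m(π|k|) e^{-imΦ(k)} /
(2 (π²|k|² - z_{nm}²))`. -/
def kernelCoeff (a : ℝ) (n : ℕ) (m : ℤ) (k : Fin 2 → ℤ) : ℂ :=
  (Real.sqrt Real.pi : ℂ) * (-1) ^ n * Complex.I ^ m.natAbs * (radialFreq a n m : ℂ) *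
    ((besselQuot n m (Real.pi * latticeNorm k) : ℝ) : ℂ) *
    Complex.exp (-Complex.I * m * (latticeAngle k : ℂ)) / 2

end FourierBessel

end

/-!
The Fourier-Bessel coefficient of `ξ` is the inner product in `L²` of the disk of `ξ` and `Ψ_{nm}`,
hence the inner product in `L²([-a, a]²)` of their extensions by zero. Parseval's identity on the
square (`hasSum_conj_squareFourier_mul`, transported from Mathlib's Fourier series on the torus)
expands it into the absolutely convergent series of the products of the Fourier coefficients, and
it remains to compute those of `Ψ_{nm}` (`conj_diskFourier_planeBasisFn`).

In polar coordinates (`integral_closedBall_eq_polar`) the angular integral is Bessel's integral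
(`integral_exp_mul_exp_cos`), and leaves the radial integral of `r J_m(ρ_{nm} r) J_m(π |k| r / a)`
over `[0, a]`. Bessel's equation evaluates it: through Lommel's formula (`lommel_integral`) if
`π |k| ≠ z_{nm}`, and through the energy identity (`integral_mul_besselJ_sq`) if `π |k| = z_{nm}`,
which is the limit value in the definition of the kernel.

The factor `(-1)^n i^|m|` is `i^m` times the sign of `J_m'(z_{nm})`, for which the zeros have to be
known. They are simple, by the energy identity; there are infinitely many of them, by Sturm
comparison with a sine (`exists_besselJ_eq_zero`); and `J_m` is positive near `0` for `m ≥ 0`. So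
the zeros can be listed in increasing order with alternating signs of the derivative
(`exists_zero_encard_eq`), and `besselZero m n` is the `n`-th of them (`besselZero_spec`). All facts
about `J_m` are derived from its defining integral, by way of the three-term recurrence
`besselJ_sub_one_add_besselJ_add_one` and the derivative formula `hasDerivAt_besselJ`.
-/

noncomputable section

namespace FourierBessel

open MeasureTheory
open scoped Real ComplexConjugate

/-! ### Recurrences, Bessel's equation and Lommel's integral -/

section Bessel

open intervalIntegral

/-- Differentiation under Bessel's integral. -/
theorem hasDerivAt_besselJ (m : ℤ) (x : ℝ) :
    HasDerivAt (besselJ m) ((besselJ (m - 1) x - besselJ (m + 1) x) / 2) x := by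
  have key := (hasDerivAt_integral_of_dominated_loc_of_deriv_le (μ := volume)
    (a := 0) (b := Real.pi) (s := Set.univ) (bound := fun _ => 1)
    (F := fun x τ => Real.cos (m * τ - x * Real.sin τ))
    (F' := fun x τ => Real.sin τ * Real.sin (m * τ - x * Real.sin τ)) (x₀ := x)
    Filter.univ_mem
    (Filter.Eventually.of_forall fun y => by
      apply Continuous.aestronglyMeasurable; fun_prop)
    (by apply Continuous.intervalIntegrable; fun_prop)
    (by apply Continuous.aestronglyMeasurable; fun_prop)
    (Filter.Eventually.of_forall fun τ _ y _ => by
      rw [norm_mul, Real.norm_eq_abs, Real.norm_eq_abs]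
      exact mul_le_one₀ (Real.abs_sin_le_one _) (abs_nonneg _) (Real.abs_sin_le_one _))
    (by simp)
    (Filter.Eventually.of_forall fun τ _ y _ => by
      have h : HasDerivAt (fun y : ℝ => (m : ℝ) * τ - y * Real.sin τ) (-Real.sin τ) y := by
        simpa using ((hasDerivAt_id y).mul_const (Real.sin τ)).const_sub ((m : ℝ) * τ)
      exact h.cos.congr_deriv (by ring))).2
  refine (key.const_mul (1 / π)).congr_deriv ?_
  unfold besselJ
  rw [← mul_sub, ← intervalIntegral.integral_sub, mul_div_assoc,
    ← intervalIntegral.integral_div]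
  · congr 1
    refine integral_congr fun τ _ => ?_
    push_cast
    have h1 : ((m : ℝ) - 1) * τ - x * Real.sin τ = (m * τ - x * Real.sin τ) - τ := by ring
    have h2 : ((m : ℝ) + 1) * τ - x * Real.sin τ = (m * τ - x * Real.sin τ) + τ := by ring
    simp only [h1, h2, Real.cos_sub _ τ, Real.cos_add _ τ]
    ring
  all_goals apply Continuous.intervalIntegrable; fun_prop

theorem continuous_besselJ (m : ℤ) : Continuous (besselJ m) :=
  continuous_iff_continuousAt.2 fun x => (hasDerivAt_besselJ m x).continuousAt

theorem deriv_besselJ (m : ℤ) :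
    deriv (besselJ m) = fun x => (besselJ (m - 1) x - besselJ (m + 1) x) / 2 :=
  funext fun x => (hasDerivAt_besselJ m x).deriv

theorem continuous_deriv_besselJ (m : ℤ) : Continuous (deriv (besselJ m)) := by
  rw [deriv_besselJ]
  exact ((continuous_besselJ _).sub (continuous_besselJ _)).div_const _

/-- The three-term recurrence: the difference of its two sides is the integral of the derivative
of `sin (m τ - x sin τ)` over `[0, π]`. -/
theorem besselJ_sub_one_add_besselJ_add_one (m : ℤ) (x : ℝ) :
    x * (besselJ (m - 1) x + besselJ (m + 1) x) = 2 * m * besselJ m x := by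
  have h0 : ∫ τ in (0 : ℝ)..π, Real.cos (m * τ - x * Real.sin τ) * (m - x * Real.cos τ) = 0 := by
    rw [integral_eq_sub_of_hasDerivAt (f := fun τ => Real.sin (m * τ - x * Real.sin τ))]
    · simp [Real.sin_int_mul_pi]
    · intro τ _
      have h : HasDerivAt (fun τ : ℝ => (m : ℝ) * τ - x * Real.sin τ) (m - x * Real.cos τ) τ := by
        simpa using ((hasDerivAt_id τ).const_mul (m : ℝ)).fun_sub
          ((Real.hasDerivAt_sin τ).const_mul x)
      exact h.sin
    · apply Continuous.intervalIntegrable; fun_prop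
  unfold besselJ
  rw [← mul_add, ← intervalIntegral.integral_add]
  · have h3 : ∀ τ : ℝ, Real.cos (m * τ - x * Real.sin τ) * (m - x * Real.cos τ) =
        m * Real.cos (m * τ - x * Real.sin τ) - x / 2 *
        (Real.cos (((m - 1 : ℤ) : ℝ) * τ - x * Real.sin τ) +
          Real.cos (((m + 1 : ℤ) : ℝ) * τ - x * Real.sin τ)) := by
      intro τ
      push_cast
      have h1 : ((m : ℝ) - 1) * τ - x * Real.sin τ = (m * τ - x * Real.sin τ) - τ := by ring
      have h2 : ((m : ℝ) + 1) * τ - x * Real.sin τ = (m * τ - x * Real.sin τ) + τ := by ring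
      simp only [h1, h2, Real.cos_sub _ τ, Real.cos_add _ τ]
      ring
    simp only [h3] at h0
    rw [intervalIntegral.integral_sub, intervalIntegral.integral_const_mul,
      intervalIntegral.integral_const_mul] at h0
    · linear_combination (-2 / π) * h0
    all_goals apply Continuous.intervalIntegrable; fun_prop
  all_goals apply Continuous.intervalIntegrable; fun_prop

/-- The reflection `τ ↦ π - τ` in Bessel's integral. -/
theorem besselJ_neg (m : ℤ) (x : ℝ) : besselJ (-m) x = (-1) ^ m.natAbs * besselJ m x := by
  have hc : Real.cos (m * π) = (-1) ^ m.natAbs := by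
    rw [Real.cos_int_mul_pi]
    rcases Int.natAbs_eq m with h | h
    · conv_lhs => rw [h]
      exact zpow_natCast _ _
    · conv_lhs => rw [h]
      rw [zpow_neg, zpow_natCast, ← inv_pow]; norm_num
  unfold besselJ
  have h := intervalIntegral.integral_comp_sub_left (a := 0) (b := π)
    (fun τ => Real.cos (((-m : ℤ) : ℝ) * τ - x * Real.sin τ)) π
  simp only [sub_self, sub_zero] at h
  rw [← h, mul_left_comm ((-1 : ℝ) ^ m.natAbs),
    ← intervalIntegral.integral_const_mul ((-1 : ℝ) ^ m.natAbs)]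
  refine congrArg (1 / π * ·) (intervalIntegral.integral_congr fun τ _ => ?_)
  simp only [Real.sin_pi_sub]
  push_cast
  rw [show -(m : ℝ) * (π - τ) - x * Real.sin τ = (m * τ - x * Real.sin τ) - m * π by ring,
    Real.cos_sub, Real.sin_int_mul_pi, hc]
  ring

theorem besselJ_zero_zero : besselJ 0 0 = 1 := by
  simp [besselJ, Real.pi_ne_zero]

/-- `J_m(0) = 0` for `m ≠ 0`, as a product so that no case distinction on `m` is needed. -/
theorem mul_besselJ_zero (m : ℤ) : (m : ℝ) * besselJ m 0 = 0 := by
  have := besselJ_sub_one_add_besselJ_add_one m 0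
  linarith

theorem mul_deriv_besselJ (m : ℤ) (x : ℝ) :
    x * deriv (besselJ m) x = m * besselJ m x - x * besselJ (m + 1) x := by
  rw [deriv_besselJ]
  linear_combination (1 / 2) * besselJ_sub_one_add_besselJ_add_one m x

theorem mul_deriv_besselJ' (m : ℤ) (x : ℝ) :
    x * deriv (besselJ m) x = x * besselJ (m - 1) x - m * besselJ m x := by
  rw [deriv_besselJ]
  linear_combination (-1 / 2) * besselJ_sub_one_add_besselJ_add_one m x

/-- Bessel's differential equation in self-adjoint form, `x (x J')' = (m² - x²) J`. The existential
avoids a division, so that the statement includes `x = 0`. -/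
theorem exists_hasDerivAt_mul_deriv_besselJ (m : ℤ) (x : ℝ) :
    ∃ d, HasDerivAt (fun x => x * deriv (besselJ m) x) d x ∧
      x * d = ((m : ℝ) ^ 2 - x ^ 2) * besselJ m x := by
  have hf : (fun x => x * deriv (besselJ m) x) =
      fun x => m * besselJ m x - x * besselJ (m + 1) x := funext (mul_deriv_besselJ m)
  have hd : ∀ m x, HasDerivAt (besselJ m) (deriv (besselJ m) x) x := fun m x =>
    (hasDerivAt_besselJ m x).differentiableAt.hasDerivAt
  rw [hf]
  refine ⟨_, ((hd m x).const_mul (m : ℝ)).fun_sub ((hasDerivAt_id' x).fun_mul (hd (m + 1) x)), ?_⟩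
  have h1 := mul_deriv_besselJ m x
  have h2 := mul_deriv_besselJ' (m + 1) x
  push_cast at h2
  rw [add_sub_cancel_right] at h2
  linear_combination (m : ℝ) * h1 - x * h2

theorem hasDerivAt_mul_deriv_besselJ (m : ℤ) {x : ℝ} (hx : x ≠ 0) :
    HasDerivAt (fun x => x * deriv (besselJ m) x) (((m : ℝ) ^ 2 / x - x) * besselJ m x) x := by
  obtain ⟨d, hd, h⟩ := exists_hasDerivAt_mul_deriv_besselJ m x
  refine hd.congr_deriv ?_
  field_simp
  linarith

/-- The energy `(x J')² + (x² - m²) J²` vanishes at `0` and has derivative `2 x J²` by Bessel's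
equation. This gives both the simplicity of the zeros and the norm of the radial functions. -/
theorem integral_mul_besselJ_sq (m : ℤ) {z : ℝ} (hz : 0 ≤ z) :
    ∫ x in (0 : ℝ)..z, 2 * x * besselJ m x ^ 2 =
      (z * deriv (besselJ m) z) ^ 2 + (z ^ 2 - (m : ℝ) ^ 2) * besselJ m z ^ 2 := by
  have hJ := continuous_besselJ m
  have hJ' := continuous_deriv_besselJ m
  rw [integral_eq_sub_of_hasDerivAt_of_le (f := fun x => (x * deriv (besselJ m) x) ^ 2 +
    (x ^ 2 - (m : ℝ) ^ 2) * besselJ m x ^ 2) hz]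
  · have := mul_besselJ_zero m
    have h2 : (m : ℝ) ^ 2 * besselJ m 0 ^ 2 = 0 := by rw [← mul_pow, this]; simp
    linear_combination h2
  · fun_prop
  · intro x hx
    have h1 := hasDerivAt_mul_deriv_besselJ m hx.1.ne'
    have h2 := (hasDerivAt_besselJ m x).differentiableAt.hasDerivAt
    have hx0 := hx.1.ne'
    refine ((h1.fun_pow 2).fun_add ((((hasDerivAt_id' x).fun_pow 2).sub_const
      ((m : ℝ) ^ 2)).fun_mul (h2.fun_pow 2))).congr_deriv ?_
    norm_num
    field_simp
    ring
  · apply Continuous.intervalIntegrable; fun_prop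

/-- Lommel's integral: the Wronskian-type expression on the right differentiates to the integrand
by Bessel's equation. -/
theorem lommel_integral (m : ℤ) (p q : ℝ) {a : ℝ} (ha : 0 ≤ a) :
    (q ^ 2 - p ^ 2) * ∫ r in (0 : ℝ)..a, r * (besselJ m (p * r) * besselJ m (q * r)) =
      p * a * deriv (besselJ m) (p * a) * besselJ m (q * a) -
        q * a * deriv (besselJ m) (q * a) * besselJ m (p * a) := by
  have hJ := continuous_besselJ m
  have hJ' := continuous_deriv_besselJ m
  rw [← intervalIntegral.integral_const_mul,
    integral_eq_sub_of_hasDerivAt_of_le (f := fun r =>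
      p * r * deriv (besselJ m) (p * r) * besselJ m (q * r) -
        q * r * deriv (besselJ m) (q * r) * besselJ m (p * r)) ha]
  · simp
  · fun_prop
  · intro r hr
    have hr0 := hr.1.ne'
    have hJd : ∀ p, HasDerivAt (fun r => besselJ m (p * r)) (deriv (besselJ m) (p * r) * p) r := by
      intro p
      have h := (hasDerivAt_besselJ m (p * r)).differentiableAt.hasDerivAt
      exact h.comp r (by simpa using (hasDerivAt_id r).const_mul p)
    have hL : ∀ p, HasDerivAt (fun r => p * r * deriv (besselJ m) (p * r))
        (((m : ℝ) ^ 2 - (p * r) ^ 2) * besselJ m (p * r) / r) r := by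
      intro p
      obtain ⟨d, hd, h⟩ := exists_hasDerivAt_mul_deriv_besselJ m (p * r)
      refine (hd.comp r (by simpa using (hasDerivAt_id r).const_mul p :
        HasDerivAt (fun r => p * r) p r)).congr_deriv ?_
      rw [← h]
      field_simp
    refine (((hL p).fun_mul (hJd q)).fun_sub ((hL q).fun_mul (hJd p))).congr_deriv ?_
    field_simp
    ring
  · apply Continuous.intervalIntegrable; fun_prop

/-! ### Positive zeros of Bessel functions -/

/-- All Bessel functions of order `m ≥ 0` are positive on a common interval `(0, δ)`: this holds
for `J_0` since `J_0(0) = 1`, and passes from `m` to `m + 1` by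
`(x^(m+1) J_(m+1))' = x^(m+1) J_m`. -/
theorem exists_forall_besselJ_pos :
    ∃ δ > 0, ∀ m : ℕ, ∀ x ∈ Set.Ioo 0 δ, 0 < besselJ m x := by
  have h0 : ∀ᶠ x in nhds (0 : ℝ), 0 < besselJ 0 x :=
    (continuous_besselJ 0).continuousAt.eventually (lt_mem_nhds (by simp [besselJ_zero_zero]))
  obtain ⟨δ, hδ, h⟩ := Metric.eventually_nhds_iff.1 h0
  refine ⟨δ, hδ, fun m => ?_⟩
  induction m with
  | zero =>
    intro x hx
    exact h (by rw [Real.dist_0_eq_abs, abs_of_pos hx.1]; exact hx.2)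
  | succ m ih =>
    intro x hx
    have hd : ∀ y : ℝ, HasDerivAt (fun y => y ^ (m + 1) * besselJ (m + 1 : ℕ) y)
        (y ^ (m + 1) * besselJ m y) y := by
      intro y
      have h1 := (hasDerivAt_besselJ (m + 1 : ℕ) y).differentiableAt.hasDerivAt
      refine (((hasDerivAt_id' y).fun_pow (m + 1)).fun_mul h1).congr_deriv ?_
      have h2 := mul_deriv_besselJ' (m + 1 : ℕ) y
      push_cast at h2 ⊢
      rw [add_sub_cancel_right] at h2
      linear_combination y ^ m * h2
    have hmono : StrictMonoOn (fun y : ℝ => y ^ (m + 1) * besselJ (m + 1 : ℕ) y)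
        (Set.Icc 0 x) := by
      refine strictMonoOn_of_deriv_pos (convex_Icc 0 x)
        (fun y _ => (hd y).continuousAt.continuousWithinAt) fun y hy => ?_
      rw [interior_Icc] at hy
      rw [(hd y).deriv]
      exact mul_pos (pow_pos hy.1 _) (ih y ⟨hy.1, hy.2.trans hx.2⟩)
    have h3 := hmono (Set.left_mem_Icc.2 hx.1.le) (Set.right_mem_Icc.2 hx.1.le) hx.1
    simp only [ne_eq, Nat.add_eq_zero_iff, one_ne_zero, and_false, not_false_eq_true, zero_pow,
      zero_mul] at h3
    exact (mul_pos_iff_of_pos_left (pow_pos hx.1 _)).1 h3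

/-- The positive zeros of a Bessel function are simple: at a zero `z` the energy identity reads
`(z J'(z))² = ∫₀ᶻ 2 x J²`, and `J` does not vanish near `0`. -/
theorem deriv_besselJ_ne_zero (m : ℕ) {z : ℝ} (hz : 0 < z) (h : besselJ m z = 0) :
    deriv (besselJ m) z ≠ 0 := by
  intro h'
  have hJ := continuous_besselJ m
  have h1 := integral_mul_besselJ_sq m hz.le
  rw [h, h'] at h1
  obtain ⟨δ, hδ, hpos⟩ := exists_forall_besselJ_pos
  have hc : 0 < min (δ / 2) (z / 2) := by positivity
  have h2 : 0 < ∫ x in (0 : ℝ)..z, 2 * x * besselJ m x ^ 2 := by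
    refine intervalIntegral.integral_pos hz (by fun_prop) (fun x hx => ?_)
      ⟨min (δ / 2) (z / 2), ?_, ?_⟩
    · have := hx.1
      positivity
    · exact ⟨hc.le, by linarith [min_le_right (δ / 2) (z / 2)]⟩
    · have := hpos m (min (δ / 2) (z / 2)) ⟨hc, by linarith [min_le_left (δ / 2) (z / 2)]⟩
      positivity
  simp at h1
  linarith

/-- Sturm comparison of `√x J_m(x)` with `sin ((x - X) / 2)`: a Bessel function has a zero on
`[X, X + 2π]` once `2 |m| ≤ X`. -/
theorem exists_besselJ_eq_zero (m : ℤ) {X : ℝ} (hX : 0 < X) (hmX : 4 * (m : ℝ) ^ 2 ≤ X ^ 2) :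
    ∃ z ∈ Set.Icc X (X + 2 * π), besselJ m z = 0 := by
  by_contra! hne
  have hJ := continuous_besselJ m
  have hJ' := continuous_deriv_besselJ m
  have hXπ : X < X + 2 * π := by linarith [Real.pi_pos]
  -- `J_m` has a constant sign, that of `s`, on the interval.
  obtain ⟨s, hs⟩ : ∃ s : ℝ, ∀ x ∈ Set.Icc X (X + 2 * π), 0 < s * besselJ m x := by
    refine ⟨besselJ m X, fun x hx => ?_⟩
    by_contra! hle
    have h1 : (0 : ℝ) ∈ Set.Icc (besselJ m X * besselJ m x) (besselJ m X * besselJ m X) :=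
      ⟨hle, mul_self_nonneg _⟩
    obtain ⟨y, hy, h0⟩ := intermediate_value_Icc' hx.1
      (f := fun y => besselJ m X * besselJ m y) (by fun_prop) h1
    rcases mul_eq_zero.1 h0 with h | h
    · exact hne X (Set.left_mem_Icc.2 hXπ.le) h
    · exact hne y ⟨hy.1, hy.2.trans hx.2⟩ h
  let S : ℝ → ℝ := fun x => Real.sin ((x - X) / 2)
  let C : ℝ → ℝ := fun x => Real.cos ((x - X) / 2)
  -- `W` is the Wronskian of `√x J_m` and `S`, up to the factor `s`. Its derivative is nonnegative
  -- because the coefficient `1 - (m² - 1/4) / x²` in the equation of `√x J_m` is at least `1/4`.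
  let W : ℝ → ℝ := fun x => s * ((x * besselJ m x * C x / 2 -
    (besselJ m x / 2 + x * deriv (besselJ m) x) * S x) / √x)
  have hW : ∀ x, 0 < x → HasDerivAt W
      (√x * (s * besselJ m x) * S x * (3 / 4 - ((m : ℝ) ^ 2 - 1 / 4) / x ^ 2)) x := by
    intro x hx
    have hl : HasDerivAt (fun x : ℝ => (x - X) / 2) (1 / 2) x :=
      ((hasDerivAt_id' x).sub_const X).div_const 2
    have hS : HasDerivAt S (C x * (1 / 2)) x := hl.sin
    have hC : HasDerivAt C (-S x * (1 / 2)) x := hl.cos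
    have h1 := (hasDerivAt_besselJ m x).differentiableAt.hasDerivAt
    have h2 := hasDerivAt_mul_deriv_besselJ m hx.ne'
    have h3 := Real.hasDerivAt_sqrt hx.ne'
    have hsq : √x ≠ 0 := (Real.sqrt_pos.2 hx).ne'
    refine ((((((hasDerivAt_id' x).fun_mul h1).fun_mul hC).div_const 2).fun_sub
      (((h1.div_const 2).fun_add h2).fun_mul hS)).fun_div h3 hsq |>.const_mul s).congr_deriv ?_
    obtain ⟨q, hq, rfl⟩ : ∃ q : ℝ, 0 < q ∧ q ^ 2 = x :=
      ⟨√x, Real.sqrt_pos.2 hx, Real.sq_sqrt hx.le⟩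
    rw [Real.sqrt_sq hq.le]
    field_simp
    ring
  have hmono : MonotoneOn W (Set.Icc X (X + 2 * π)) := by
    refine monotoneOn_of_deriv_nonneg (convex_Icc _ _)
      (fun x hx => (hW x (hX.trans_le hx.1)).continuousAt.continuousWithinAt)
      (fun x hx => ?_) fun x hx => ?_
    · rw [interior_Icc] at hx
      exact (hW x (hX.trans hx.1)).differentiableAt.differentiableWithinAt
    · rw [interior_Icc] at hx
      have hx0 := hX.trans hx.1
      rw [(hW x hx0).deriv]
      have hS : 0 ≤ S x := Real.sin_nonneg_of_nonneg_of_le_pi (by linarith [hx.1])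
        (by linarith [hx.2])
      have hq : 0 ≤ 3 / 4 - ((m : ℝ) ^ 2 - 1 / 4) / x ^ 2 := by
        rw [sub_nonneg, div_le_iff₀ (by positivity)]
        nlinarith [hx.1]
      have := hs x (Set.Ioo_subset_Icc_self hx)
      positivity
  -- But `W` is positive at the left endpoint and negative at the right one.
  have h := hmono (Set.left_mem_Icc.2 hXπ.le) (Set.right_mem_Icc.2 hXπ.le) hXπ.le
  have h1 := hs X (Set.left_mem_Icc.2 hXπ.le)
  have h2 := hs (X + 2 * π) (Set.right_mem_Icc.2 hXπ.le)
  have hWX : W X = √X * (s * besselJ m X) / 2 := by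
    simp only [W, S, C, sub_self, zero_div, Real.sin_zero, Real.cos_zero]
    rw [mul_zero, sub_zero]
    nth_rewrite 1 [← Real.mul_self_sqrt hX.le]
    have : √X ≠ 0 := (Real.sqrt_pos.2 hX).ne'
    field_simp
  have hWY : W (X + 2 * π) = -(√(X + 2 * π) * (s * besselJ m (X + 2 * π)) / 2) := by
    simp only [W, S, C, show (X + 2 * π - X) / 2 = π by ring, Real.sin_pi, Real.cos_pi]
    rw [mul_zero, sub_zero]
    nth_rewrite 1 [← Real.mul_self_sqrt (hX.trans hXπ).le]
    have : √(X + 2 * π) ≠ 0 := (Real.sqrt_pos.2 (hX.trans hXπ)).ne'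
    field_simp
  rw [hWX, hWY] at h
  have h3 := mul_pos (Real.sqrt_pos.2 hX) h1
  have h4 := mul_pos (Real.sqrt_pos.2 (hX.trans hXπ)) h2
  linarith

/-- The first zero of a function to the right of an interval on which it is positive, provided it
is a simple zero. -/
theorem exists_first_zero {f : ℝ → ℝ} (hf : Continuous f) {x₀ b c : ℝ} (hb : x₀ < b)
    (hpos : ∀ y ∈ Set.Ioo x₀ b, 0 < f y) (hbc : b ≤ c) (hc : f c = 0)
    (hsimple : ∀ z, x₀ < z → f z = 0 → deriv f z ≠ 0) :
    ∃ z, x₀ < z ∧ f z = 0 ∧ deriv f z < 0 ∧ ∀ y ∈ Set.Ioo x₀ z, 0 < f y := by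
  obtain ⟨z, ⟨hz, hz0⟩, hleast⟩ := (isCompact_Icc.inter_right
    (isClosed_singleton.preimage hf) : IsCompact (Set.Icc b c ∩ f ⁻¹' {0})).exists_isLeast
      ⟨c, ⟨hbc, le_rfl⟩, hc⟩
  have hz0 : f z = 0 := hz0
  have hxz : x₀ < z := hb.trans_le hz.1
  have hposz : ∀ y ∈ Set.Ioo x₀ z, 0 < f y := by
    intro y hy
    by_contra! hle
    have hyb : b ≤ y := by
      by_contra! h
      exact (hpos y ⟨hy.1, h⟩).not_ge hle
    have hmid : (x₀ + b) / 2 ∈ Set.Ioo x₀ b := ⟨by linarith, by linarith⟩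
    obtain ⟨w, hw, hw0⟩ := intermediate_value_Icc' (hmid.2.le.trans hyb) hf.continuousOn
      ⟨hle, (hpos _ hmid).le⟩
    have hwb : b ≤ w := by
      by_contra! h
      exact (hpos w ⟨hmid.1.trans_le hw.1, h⟩).ne' hw0
    have := hleast ⟨⟨hwb, (hw.2.trans hy.2.le).trans hz.2⟩, hw0⟩
    exact absurd hy.2 (not_lt.2 (this.trans hw.2))
  refine ⟨z, hxz, hz0, lt_of_le_of_ne ?_ (hsimple z hxz hz0), hposz⟩
  by_contra! hd
  have h1 := (eventually_nhdsWithin_sign_eq_of_deriv_pos hd hz0).filter_mono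
    (nhdsWithin_le_nhds (s := Set.Iio z))
  have h2 : ∀ᶠ y in nhdsWithin z (Set.Iio z), y ∈ Set.Ioo x₀ z := Ioo_mem_nhdsLT hxz
  obtain ⟨y, hy1, hy2⟩ := (h1.and h2).exists
  rw [sign_pos (hposz y hy2), sign_neg (sub_neg.2 hy2.2)] at hy1
  exact absurd hy1 (by decide)

/-- For order `m ≥ 0`, the positive zeros can be enumerated in increasing order, and the sign of
the derivative alternates along them. -/
theorem exists_zero_encard_eq (m n : ℕ) :
    ∃ z, 0 < z ∧ besselJ m z = 0 ∧
      Set.encard {y : ℝ | 0 < y ∧ y < z ∧ besselJ m y = 0} = n ∧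
      0 < (-1) ^ (n + 1) * deriv (besselJ m) z := by
  -- One step: from positivity of `(-1)^n J_m` to the right of `x₀` to its next zero.
  have step : ∀ (n : ℕ) (x₀ b : ℝ), 0 ≤ x₀ → x₀ < b →
      (∀ y ∈ Set.Ioo x₀ b, 0 < (-1) ^ n * besselJ m y) →
      ∃ z, x₀ < z ∧ besselJ m z = 0 ∧ 0 < (-1) ^ (n + 1) * deriv (besselJ m) z ∧
        ∀ y ∈ Set.Ioo x₀ z, besselJ m y ≠ 0 := by
    intro n x₀ b hx₀ hb hpos
    -- Some zero lies beyond `b`; the shift by `2 |m|` makes the comparison applicable.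
    obtain ⟨c, hc, hc0⟩ := exists_besselJ_eq_zero m (X := b + 2 * |(m : ℝ)|)
      (by positivity [hx₀.trans_lt hb]) (by
        have : 0 < b := hx₀.trans_lt hb
        have h2 := sq_abs (m : ℝ)
        push_cast
        nlinarith [abs_nonneg (m : ℝ)])
    have hderiv : ∀ z, deriv (fun y => (-1) ^ n * besselJ m y) z =
        (-1) ^ n * deriv (besselJ m) z := fun z =>
      deriv_const_mul _ (hasDerivAt_besselJ m z).differentiableAt
    have hJ := continuous_besselJ m
    obtain ⟨z, hz, hz0, hz', h⟩ := exists_first_zero (f := fun y => (-1) ^ n * besselJ m y)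
      (by fun_prop) hb hpos (c := c) (by linarith [hc.1, abs_nonneg (m : ℝ)])
      (by simp [hc0]) (by
        intro z hz h0
        rw [hderiv]
        have h0 : besselJ m z = 0 := by simpa using h0
        exact mul_ne_zero (by simp) (deriv_besselJ_ne_zero m (hx₀.trans_lt hz) h0))
    rw [hderiv] at hz'
    exact ⟨z, hz, by simpa using hz0, by rw [pow_succ]; linarith, fun y hy h0 => by
      have := h y hy
      simp [h0] at this⟩
  induction n with
  | zero =>
    obtain ⟨δ, hδ, hpos⟩ := exists_forall_besselJ_pos
    obtain ⟨z, hz, hz0, hz', h⟩ := step 0 0 δ le_rfl hδ (by simpa using hpos m)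
    refine ⟨z, hz, hz0, ?_, hz'⟩
    simp only [Nat.cast_zero, Set.encard_eq_zero]
    exact Set.eq_empty_of_forall_notMem fun y hy => h y ⟨hy.1, hy.2.1⟩ hy.2.2
  | succ n ih =>
    obtain ⟨w, hw, hw0, hcard, hw'⟩ := ih
    have hd : 0 < deriv (fun y => (-1) ^ (n + 1) * besselJ m y) w := by
      rwa [deriv_const_mul _ (hasDerivAt_besselJ m w).differentiableAt]
    have h1 := (eventually_nhdsWithin_sign_eq_of_deriv_pos hd (by simp [hw0]))
    obtain ⟨ε, hε, h2⟩ := Metric.eventually_nhds_iff.1 h1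
    obtain ⟨z, hz, hz0, hz', h⟩ := step (n + 1) w (w + ε) hw.le (by linarith) (by
      intro y hy
      have h3 := h2 (y := y) (by
        rw [Real.dist_eq, abs_of_pos (sub_pos.2 hy.1)]; linarith [hy.2])
      rw [sign_pos (sub_pos.2 hy.1)] at h3
      exact sign_eq_one_iff.1 h3)
    refine ⟨z, hw.trans hz, hz0, ?_, hz'⟩
    have hset : {y : ℝ | 0 < y ∧ y < z ∧ besselJ m y = 0} =
        insert w {y : ℝ | 0 < y ∧ y < w ∧ besselJ m y = 0} := by
      ext y
      simp only [Set.mem_ofPred_eq, Set.mem_insert_iff]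
      constructor
      · rintro ⟨hy, hyz, hy0⟩
        rcases lt_trichotomy y w with h3 | h3 | h3
        · exact Or.inr ⟨hy, h3, hy0⟩
        · exact Or.inl h3
        · exact absurd hy0 (h y ⟨h3, hyz⟩)
      · rintro (rfl | ⟨hy, hyw, hy0⟩)
        · exact ⟨hw, hz, hw0⟩
        · exact ⟨hy, hyw.trans hz, hy0⟩
    rw [hset, Set.encard_insert_of_notMem (by simp), hcard]
    norm_cast

theorem besselZero_neg (m : ℤ) (n : ℕ) : besselZero (-m) n = besselZero m n := by
  have h : ∀ x, besselJ (-m) x = 0 ↔ besselJ m x = 0 := fun x => by simp [besselJ_neg]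
  simp only [besselZero, h]

/-- For `m ≥ 0`, `besselZero m n` is a positive zero of `J_m` at which `J_m'` has the sign `(-1)^n`.
The set whose infimum defines it has exactly one element. -/
theorem besselZero_spec (m : ℕ) {n : ℕ} (hn : 1 ≤ n) :
    0 < besselZero m n ∧ besselJ m (besselZero m n) = 0 ∧
      0 < (-1) ^ n * deriv (besselJ m) (besselZero m n) := by
  obtain ⟨k, rfl⟩ := Nat.exists_eq_add_of_le' hn
  obtain ⟨z, hz, hz0, hcard, hz'⟩ := exists_zero_encard_eq m k
  suffices h : besselZero m (k + 1) = z by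
    rw [h]; exact ⟨hz, hz0, hz'⟩
  have hlt : ∀ x y : ℝ, 0 < x → besselJ m x = 0 → x < y →
      Set.encard {w : ℝ | 0 < w ∧ w < x ∧ besselJ m w = 0} + 1 ≤
        Set.encard {w : ℝ | 0 < w ∧ w < y ∧ besselJ m w = 0} := by
    intro x y hx hx0 hxy
    rw [← Set.encard_insert_of_notMem (a := x) (by simp)]
    refine Set.encard_le_encard ?_
    rintro w (rfl | ⟨hw, hwx, hw0⟩)
    · exact ⟨hx, hxy, hx0⟩
    · exact ⟨hw, hwx.trans hxy, hw0⟩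
  have hset : {x : ℝ | 0 < x ∧ besselJ m x = 0 ∧
      Set.encard {y : ℝ | 0 < y ∧ y < x ∧ besselJ m y = 0} + 1 = ((k + 1 : ℕ) : ℕ∞)} = {z} := by
    ext x
    simp only [Set.mem_ofPred_eq, Set.mem_singleton_iff]
    constructor
    · rintro ⟨hx, hx0, hxc⟩
      have hxc : Set.encard {y : ℝ | 0 < y ∧ y < x ∧ besselJ m y = 0} = k := by
        push_cast at hxc
        exact WithTop.add_right_cancel ENat.one_ne_top hxc
      rcases lt_trichotomy x z with h | h | h
      · have := hlt x z hx hx0 h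
        rw [hxc, hcard] at this
        norm_cast at this
        omega
      · exact h
      · have := hlt z x hz hz0 h
        rw [hxc, hcard] at this
        norm_cast at this
        omega
    · rintro rfl
      exact ⟨hz, hz0, by rw [hcard]; norm_cast⟩
  rw [besselZero, hset, csInf_singleton]

theorem besselZero_pos (m : ℤ) {n : ℕ} (hn : 1 ≤ n) : 0 < besselZero m n := by
  obtain ⟨k, rfl | rfl⟩ := m.eq_nat_or_neg
  · exact (besselZero_spec k hn).1
  · rw [besselZero_neg]; exact (besselZero_spec k hn).1

theorem besselJ_besselZero (m : ℤ) {n : ℕ} (hn : 1 ≤ n) : besselJ m (besselZero m n) = 0 := by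
  obtain ⟨k, rfl | rfl⟩ := m.eq_nat_or_neg
  · exact (besselZero_spec k hn).2.1
  · rw [besselZero_neg, besselJ_neg, (besselZero_spec k hn).2.1, mul_zero]

/-- The sign of `J_m'(z_{nm})`, with the factors `i^m` and `i^|m|` that make the formula uniform in
the sign of `m`. -/
theorem I_zpow_mul_deriv_besselJ_besselZero (m : ℤ) {n : ℕ} (hn : 1 ≤ n) :
    Complex.I ^ m * (deriv (besselJ m) (besselZero m n) : ℝ) =
      (-1) ^ n * Complex.I ^ m.natAbs * (|deriv (besselJ m) (besselZero m n)| : ℝ) := by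
  have hnat : ∀ k : ℕ, |deriv (besselJ k) (besselZero k n)| =
      (-1) ^ n * deriv (besselJ k) (besselZero k n) := by
    intro k
    have h := (besselZero_spec k hn).2.2
    rw [← abs_of_pos h, abs_mul, abs_pow, abs_neg, abs_one, one_pow, one_mul]
  have hsq : ((-1 : ℂ) ^ n) * (-1) ^ n = 1 := by rw [← mul_pow]; norm_num
  obtain ⟨k, rfl | rfl⟩ := m.eq_nat_or_neg
  · rw [hnat]
    push_cast
    rw [zpow_natCast, Int.natAbs_natCast]
    linear_combination (-Complex.I ^ k * (deriv (besselJ k) (besselZero k n) : ℝ)) * hsq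
  · have hd : deriv (besselJ (-(k : ℤ))) (besselZero k n) =
        (-1) ^ k * deriv (besselJ k) (besselZero k n) := by
      rw [show besselJ (-(k : ℤ)) = fun x => (-1) ^ k * besselJ k x from
        funext fun x => by rw [besselJ_neg, Int.natAbs_natCast]]
      exact deriv_const_mul _ (hasDerivAt_besselJ k _).differentiableAt
    rw [besselZero_neg, hd, abs_mul, abs_pow, abs_neg, abs_one, one_pow, one_mul, hnat,
      zpow_neg, zpow_natCast, Int.natAbs_neg, Int.natAbs_natCast, ← inv_pow, Complex.inv_I]
    push_cast
    have hI : (-Complex.I) ^ k * (-1) ^ k = Complex.I ^ k := by rw [← mul_pow]; simp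
    linear_combination ((deriv (besselJ k) (besselZero k n) : ℝ) : ℂ) * hI -
      (Complex.I ^ k * (deriv (besselJ k) (besselZero k n) : ℝ)) * hsq

theorem deriv_besselJ_besselZero_ne_zero (m : ℤ) {n : ℕ} (hn : 1 ≤ n) :
    deriv (besselJ m) (besselZero m n) ≠ 0 := by
  intro h
  obtain ⟨k, rfl | rfl⟩ := m.eq_nat_or_neg
  · exact deriv_besselJ_ne_zero k (besselZero_spec k hn).1 (besselZero_spec k hn).2.1 h
  · rw [besselZero_neg, show besselJ (-(k : ℤ)) = fun x => (-1) ^ k * besselJ k x from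
      funext fun x => by rw [besselJ_neg, Int.natAbs_natCast],
      deriv_const_mul _ (hasDerivAt_besselJ k _).differentiableAt] at h
    exact deriv_besselJ_ne_zero k (besselZero_spec k hn).1 (besselZero_spec k hn).2.1
      (by simpa using h)

end Bessel

/-! ### Parseval's identity on a square -/

/-- The closed square `[-a, a]²`. -/
abbrev square (a : ℝ) : Set (EuclideanSpace ℝ (Fin 2)) := {x | ∀ i, x i ∈ Set.Icc (-a) a}

theorem measurableSet_square (a : ℝ) : MeasurableSet (square a) := by
  have : square a = ⋂ i, (fun x : EuclideanSpace ℝ (Fin 2) => x i) ⁻¹' Set.Icc (-a) a := by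
    ext; simp [square]
  rw [this]
  exact MeasurableSet.iInter fun i => measurableSet_Icc.preimage (by fun_prop)

section Torus

-- The normalized Haar measure on the circle, as in Mathlib's theory of multivariate Fourier series,
-- where these instances are local too.
local instance : MeasureSpace UnitAddCircle := ⟨AddCircle.haarAddCircle⟩

local instance : Measure.IsAddHaarMeasure (volume : Measure UnitAddCircle) :=
  inferInstanceAs (Measure.IsAddHaarMeasure AddCircle.haarAddCircle)

local instance : IsProbabilityMeasure (volume : Measure UnitAddCircle) :=
  inferInstanceAs (IsProbabilityMeasure AddCircle.haarAddCircle)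

/-- The inverse of the covering map `x ↦ (x i / (2 a)) mod 1`, with values in the half-open square
`(-a, a]²`. -/
def torusToSquare (a : ℝ) (t : UnitAddTorus (Fin 2)) : EuclideanSpace ℝ (Fin 2) :=
  (2 * a) • WithLp.toLp 2 fun i => (AddCircle.equivIoc 1 (-1 / 2) (t i) : ℝ)

/-- The half-open and the closed square agree up to a null set, so the closed one may be used. -/
theorem measurePreserving_torusToSquare {a : ℝ} (ha : 0 < a) :
    MeasurePreserving (torusToSquare a) volume
      (ENNReal.ofReal (4 * a ^ 2)⁻¹ • volume.restrict (square a)) := by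
  have h1 := UnitAddTorus.measurePreserving_equivPiIoc (d := Fin 2) fun _ => -1 / 2
  have h2 := measurePreserving_subtype_coe (μa := (volume : Measure (Fin 2 → ℝ)))
    (s := {x : Fin 2 → ℝ | ∀ i, x i ∈ Set.Ioc (-1 / 2 : ℝ) (-1 / 2 + 1)})
    (MeasurableSet.univ_pi' fun i => measurableSet_Ioc)
  have ha' : (2 * a) ≠ 0 := by positivity
  have hD : Measurable fun x : Fin 2 → ℝ => (2 * a) • WithLp.toLp 2 x := by fun_prop
  have hpre : (fun x : Fin 2 → ℝ => (2 * a) • WithLp.toLp 2 x) ⁻¹' square a =ᵐ[volume]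
      {x : Fin 2 → ℝ | ∀ i, x i ∈ Set.Ioc (-1 / 2 : ℝ) (-1 / 2 + 1)} := by
    have h := Measure.univ_pi_Ioc_ae_eq_Icc (μ := fun _ : Fin 2 => (volume : Measure ℝ))
      (f := fun _ => -1 / 2) (g := fun _ => -1 / 2 + 1)
    have e1 : (fun x : Fin 2 → ℝ => (2 * a) • WithLp.toLp 2 x) ⁻¹' square a =
        Set.Icc (fun _ => -1 / 2) (fun _ => -1 / 2 + 1) := by
      ext x
      simp only [square, Set.mem_preimage, Set.mem_ofPred_eq, PiLp.smul_apply, smul_eq_mul,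
        Set.mem_Icc, Pi.le_def, ← forall_and]
      refine forall_congr' fun i => and_congr ?_ ?_
      · constructor <;> intro h <;> nlinarith
      · constructor <;> intro h <;> nlinarith
    have e2 : {x : Fin 2 → ℝ | ∀ i, x i ∈ Set.Ioc (-1 / 2 : ℝ) (-1 / 2 + 1)} =
        Set.univ.pi fun _ => Set.Ioc (-1 / 2 : ℝ) (-1 / 2 + 1) := by
      ext x
      simp
    rw [e1, e2]
    exact h.symm
  have h3 : Measure.map (fun x : Fin 2 → ℝ => (2 * a) • WithLp.toLp 2 x)
      (volume.restrict {x : Fin 2 → ℝ | ∀ i, x i ∈ Set.Ioc (-1 / 2 : ℝ) (-1 / 2 + 1)}) =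
      ENNReal.ofReal (4 * a ^ 2)⁻¹ • volume.restrict (square a) := by
    rw [← Measure.restrict_congr_set hpre, ← Measure.restrict_map hD (measurableSet_square a),
      ← Measure.restrict_smul]
    congr 1
    have h4 := Measure.map_map (μ := (volume : Measure (Fin 2 → ℝ)))
      (g := fun x : EuclideanSpace ℝ (Fin 2) => (2 * a) • x) (f := WithLp.toLp 2)
      (by fun_prop) (by fun_prop)
    rw [(PiLp.volume_preserving_toLp (Fin 2)).map_eq, Measure.map_addHaar_smul _ ha',
      finrank_euclideanSpace_fin, abs_of_pos (by positivity)] at h4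
    rw [mul_pow] at h4
    norm_num at h4 ⊢
    exact h4.symm
  exact ⟨hD.comp (h2.comp h1).measurable, by
    rw [← h3, ← (h2.comp h1).map_eq, Measure.map_map hD (h2.comp h1).measurable]
    rfl⟩

/-- The monomials on the torus are the exponentials in the definition of `squareFourier`. -/
theorem mFourier_neg_eq_exp (a : ℝ) (ha : 0 < a) (k : Fin 2 → ℤ) (t : UnitAddTorus (Fin 2)) :
    UnitAddTorus.mFourier (-k) t = Complex.exp (-Complex.I *
      ((π / a * (k 0 * torusToSquare a t 0 + k 1 * torusToSquare a t 1) : ℝ) : ℂ)) := by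
  have h : ∀ i, (((AddCircle.equivIoc 1 (-1 / 2) (t i) : ℝ) : UnitAddCircle)) = t i := fun i =>
    (AddCircle.equivIoc 1 (-1 / 2)).symm_apply_apply (t i)
  have h2 : UnitAddTorus.mFourier (-k) t = ∏ i, fourier ((-k) i) (t i) := rfl
  rw [h2, Fin.prod_univ_two, ← h 0, ← h 1, fourier_coe_apply, fourier_coe_apply, ← Complex.exp_add]
  congr 1
  simp only [torusToSquare, PiLp.smul_apply, smul_eq_mul, Pi.neg_apply]
  push_cast
  have : (a : ℂ) ≠ 0 := by exact_mod_cast ha.ne'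
  field_simp
  ring

/-- Parseval's identity for the square `[-a, a]²`. -/
theorem hasSum_conj_squareFourier_mul {a : ℝ} (ha : 0 < a) {f g : EuclideanSpace ℝ (Fin 2) → ℂ}
    (hf : MemLp f 2 (volume.restrict (square a))) (hg : MemLp g 2 (volume.restrict (square a))) :
    HasSum (fun k => conj (squareFourier a f k) * squareFourier a g k)
      (4 * a ^ 2 * ∫ x in square a, conj (f x) * g x) := by
  -- Pull `f` and `g` back to the torus, where the measure is `1 / (4 a²)` times the area.
  have hT := measurePreserving_torusToSquare ha
  have hL : ∀ {f : EuclideanSpace ℝ (Fin 2) → ℂ}, MemLp f 2 (volume.restrict (square a)) →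
      MemLp (f ∘ torusToSquare a) 2 volume := fun hf =>
    (hf.smul_measure ENNReal.ofReal_ne_top).comp_measurePreserving hT
  have hint : ∀ {F : EuclideanSpace ℝ (Fin 2) → ℂ},
      AEStronglyMeasurable F (volume.restrict (square a)) →
      ∫ t, F (torusToSquare a t) = ((4 * a ^ 2 : ℝ) : ℂ)⁻¹ * ∫ x in square a, F x := by
    intro F hF
    rw [← integral_map hT.measurable.aemeasurable (by
      rw [hT.map_eq]; exact hF.smul_measure _), hT.map_eq, integral_smul_measure,
      ENNReal.toReal_ofReal (by positivity), Complex.real_smul]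
    push_cast; rfl
  have hcoef : ∀ {f : EuclideanSpace ℝ (Fin 2) → ℂ} (hf : MemLp f 2 (volume.restrict (square a)))
      (k : Fin 2 → ℤ), UnitAddTorus.mFourierCoeff ((hL hf).toLp _) k =
        ((4 * a ^ 2 : ℝ) : ℂ)⁻¹ * squareFourier a f k := by
    intro f hf k
    have hE : Continuous fun x : EuclideanSpace ℝ (Fin 2) => Complex.exp (-Complex.I *
        ((π / a * (k 0 * x 0 + k 1 * x 1) : ℝ) : ℂ)) := by fun_prop
    refine Eq.trans ?_ (hint (hf.1.mul hE.aestronglyMeasurable))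
    rw [UnitAddTorus.mFourierCoeff]
    refine integral_congr_ae ?_
    filter_upwards [(hL hf).coeFn_toLp] with t ht
    rw [ht, mFourier_neg_eq_exp a ha, smul_eq_mul, mul_comm]
    rfl
  have h := UnitAddTorus.hasSum_prod_mFourierCoeff ((hL hf).toLp _) ((hL hg).toLp _)
  have hI : ∫ t, conj ((hL hf).toLp _ t) * (hL hg).toLp _ t =
      ((4 * a ^ 2 : ℝ) : ℂ)⁻¹ * ∫ x in square a, conj (f x) * g x := by
    refine Eq.trans ?_ (hint ((Complex.continuous_conj.comp_aestronglyMeasurable hf.1).mul hg.1))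
    refine integral_congr_ae ?_
    filter_upwards [(hL hf).coeFn_toLp, (hL hg).coeFn_toLp] with t ht1 ht2
    rw [ht1, ht2]
    rfl
  rw [hI] at h
  simp_rw [hcoef hf, hcoef hg] at h
  have h4 : (a : ℂ) ≠ 0 := by exact_mod_cast ha.ne'
  convert! h.mul_left (((4 * a ^ 2 : ℝ) : ℂ) ^ 2) using 1
  · ext k
    rw [map_mul, map_inv₀, Complex.conj_ofReal]
    push_cast
    field_simp
  · push_cast
    field_simp

end Torus

/-! ### Polar coordinates on a disk -/

instance isFiniteMeasure_restrict_closedBall (a : ℝ) : IsFiniteMeasure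
    (volume.restrict (Metric.closedBall (0 : EuclideanSpace ℝ (Fin 2)) a)) :=
  ⟨by rw [Measure.restrict_apply_univ]; exact measure_closedBall_lt_top⟩

theorem norm_polarPoint {r : ℝ} (hr : 0 ≤ r) (θ : ℝ) : ‖polarPoint r θ‖ = r := by
  rw [EuclideanSpace.norm_eq, Fin.sum_univ_two]
  simp only [polarPoint, Matrix.cons_val_zero, Matrix.cons_val_one, Real.norm_eq_abs, sq_abs]
  rw [mul_pow, mul_pow, ← mul_add, Real.cos_sq_add_sin_sq, mul_one, Real.sqrt_sq hr]

theorem polarPoint_add_two_pi (r θ : ℝ) : polarPoint r (θ + 2 * π) = polarPoint r θ := by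
  simp [polarPoint]

/-- Integration over a disk in polar coordinates, as an iterated integral. -/
theorem integral_closedBall_eq_polar {a : ℝ} (ha : 0 ≤ a) {F : EuclideanSpace ℝ (Fin 2) → ℂ}
    (hF : IntegrableOn F (Metric.closedBall 0 a)) :
    ∫ x in Metric.closedBall 0 a, F x =
      ∫ r in (0 : ℝ)..a, ∫ θ in (0 : ℝ)..(2 * π), F (polarPoint r θ) * (r : ℂ) := by
  let e : ℝ × ℝ → EuclideanSpace ℝ (Fin 2) := fun p => WithLp.toLp 2 ![p.1, p.2]
  have he : MeasurePreserving e volume volume :=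
    (PiLp.volume_preserving_toLp (Fin 2)).comp (volume_preserving_finTwoArrow ℝ).symm
  have hemb : MeasurableEmbedding e :=
    (MeasurableEquiv.toLp 2 (Fin 2 → ℝ)).measurableEmbedding.comp
      (MeasurableEquiv.finTwoArrow (α := ℝ)).symm.measurableEmbedding
  let G : EuclideanSpace ℝ (Fin 2) → ℂ := (Metric.closedBall 0 a).indicator F
  have hG : Integrable G := hF.integrable_indicator Metric.isClosed_closedBall.measurableSet
  have hGe : Integrable (G ∘ e) := (he.integrable_comp_emb hemb).2 hG
  have hep : ∀ r θ, e (polarCoord.symm (r, θ)) = polarPoint r θ := fun r θ => rfl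
  -- The integrand in polar coordinates is integrable.
  have hint : IntegrableOn (fun p : ℝ × ℝ => p.1 • G (e (polarCoord.symm p)))
      polarCoord.target := by
    have h := (integrableOn_image_iff_integrableOn_abs_det_fderiv_smul volume
      polarCoord.open_target.measurableSet
      (fun p _ => (hasFDerivAt_polarCoord_symm p).hasFDerivWithinAt)
      polarCoord.symm.injOn (G ∘ e)).1 hGe.integrableOn
    refine h.congr_fun (fun p hp => ?_) polarCoord.open_target.measurableSet
    have hp1 : 0 < p.1 := hp.1
    simp only [det_fderivPolarCoordSymm, abs_of_pos hp1, Function.comp]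
  have hdisk : ∀ p ∈ polarCoord.target, p ∉ Set.Ioc 0 a ×ˢ Set.Ioo (-π) π →
      p.1 • G (e (polarCoord.symm p)) = 0 := by
    rintro ⟨r, θ⟩ ⟨hr, hθ⟩ hp
    have hr : 0 < r := hr
    have hra : a < r := by
      by_contra! h
      exact hp ⟨⟨hr, h⟩, hθ⟩
    rw [hep, show G (polarPoint r θ) = 0 from Set.indicator_of_notMem (by
      rw [mem_closedBall_zero_iff, norm_polarPoint hr.le]; exact not_le.2 hra) _, smul_zero]
  have hsub : Set.Ioc 0 a ×ˢ Set.Ioo (-π) π ⊆ polarCoord.target :=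
    Set.prod_mono (fun r hr => hr.1) subset_rfl
  calc ∫ x in Metric.closedBall 0 a, F x
      = ∫ x, G x := (integral_indicator Metric.isClosed_closedBall.measurableSet).symm
    _ = ∫ p, G (e p) := (he.integral_comp hemb G).symm
    _ = ∫ p in polarCoord.target, p.1 • G (e (polarCoord.symm p)) :=
        (integral_comp_polarCoord_symm (fun p => G (e p))).symm
    _ = ∫ p in Set.Ioc 0 a ×ˢ Set.Ioo (-π) π, p.1 • G (e (polarCoord.symm p)) :=
        setIntegral_eq_of_subset_of_forall_sdiff_eq_zero polarCoord.open_target.measurableSet hsub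
          fun p hp => hdisk p hp.1 hp.2
    _ = ∫ r in Set.Ioc 0 a, ∫ θ in Set.Ioo (-π) π, r • G (polarPoint r θ) :=
        setIntegral_prod _ (hint.mono_set hsub)
    _ = ∫ r in Set.Ioc 0 a, ∫ θ in (0 : ℝ)..(2 * π), F (polarPoint r θ) * (r : ℂ) := by
        refine setIntegral_congr_fun measurableSet_Ioc fun r hr => ?_
        have hGF : ∀ θ, r • G (polarPoint r θ) = F (polarPoint r θ) * (r : ℂ) := fun θ => by
          rw [show G (polarPoint r θ) = F (polarPoint r θ) from Set.indicator_of_mem (by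
            rw [mem_closedBall_zero_iff, norm_polarPoint hr.1.le]; exact hr.2) _,
            Complex.real_smul, mul_comm]
        simp only [hGF]
        rw [← integral_Ioc_eq_integral_Ioo,
          ← intervalIntegral.integral_of_le (by linarith [Real.pi_pos])]
        have hper : Function.Periodic (fun θ => F (polarPoint r θ) * (r : ℂ)) (2 * π) := fun θ => by
          simp only [polarPoint_add_two_pi]
        have h := hper.intervalIntegral_add_eq (-π) 0
        rwa [zero_add, show -π + 2 * π = π by ring] at h
    _ = _ := (intervalIntegral.integral_of_le ha).symm

theorem closedBall_subset_square (a : ℝ) :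
    Metric.closedBall (0 : EuclideanSpace ℝ (Fin 2)) a ⊆ square a := by
  intro x hx i
  rw [mem_closedBall_zero_iff] at hx
  exact abs_le.1 ((Real.norm_eq_abs _ ▸ PiLp.norm_apply_le x i).trans hx)

theorem squareFourier_zeroPad (a : ℝ) (f : EuclideanSpace ℝ (Fin 2) → ℂ) (k : Fin 2 → ℤ) :
    squareFourier a (zeroPad a f) k = ∫ x in Metric.closedBall 0 a,
      f x * Complex.exp (-Complex.I * ((π / a * (k 0 * x 0 + k 1 * x 1) : ℝ) : ℂ)) := by
  have hm : MeasurableSet (Metric.closedBall (0 : EuclideanSpace ℝ (Fin 2)) a) :=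
    Metric.isClosed_closedBall.measurableSet
  have h : ∀ x, zeroPad a f x *
      Complex.exp (-Complex.I * ((π / a * (k 0 * x 0 + k 1 * x 1) : ℝ) : ℂ)) =
      (Metric.closedBall 0 a).indicator (fun x => f x *
        Complex.exp (-Complex.I * ((π / a * (k 0 * x 0 + k 1 * x 1) : ℝ) : ℂ))) x := fun x => by
    rw [zeroPad, Set.indicator_mul_left]
  rw [squareFourier]
  simp only [h]
  rw [setIntegral_indicator hm, Set.inter_eq_self_of_subset_right (closedBall_subset_square a)]

/-- The polar iterated integral defining `diskFourier` is the Fourier coefficient over the square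
of the extension by zero. -/
theorem diskFourier_eq_squareFourier {a : ℝ} (ha : 0 < a) {f : EuclideanSpace ℝ (Fin 2) → ℂ}
    (hf : IntegrableOn f (Metric.closedBall 0 a)) (k : Fin 2 → ℤ) :
    diskFourier a f k = squareFourier a (zeroPad a f) k := by
  rw [squareFourier_zeroPad, integral_closedBall_eq_polar ha.le]
  · rw [diskFourier]
    simp only [polarPoint, Matrix.cons_val_zero, Matrix.cons_val_one]
    have h : ∀ r θ : ℝ, π / a * (k 0 * (r * Real.cos θ) + k 1 * (r * Real.sin θ)) =
        π / a * r * (k 0 * Real.cos θ + k 1 * Real.sin θ) := fun r θ => by ring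
    simp only [h]
  · have hE : Continuous fun x : EuclideanSpace ℝ (Fin 2) => Complex.exp (-Complex.I *
        ((π / a * (k 0 * x 0 + k 1 * x 1) : ℝ) : ℂ)) := by fun_prop
    refine hf.mul_bdd (c := 1) hE.aestronglyMeasurable (Filter.Eventually.of_forall fun x => ?_)
    rw [neg_mul, ← mul_neg, ← Complex.ofReal_neg, Complex.norm_exp_I_mul_ofReal]

/-! ### Fourier coefficients of the Fourier-Bessel functions -/

theorem exp_I_mul_int_mul_add_two_pi (m : ℤ) (x τ : ℝ) :
    Complex.exp (Complex.I * ((m * (τ + 2 * π) - x * Real.sin (τ + 2 * π) : ℝ) : ℂ)) =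
      Complex.exp (Complex.I * ((m * τ - x * Real.sin τ : ℝ) : ℂ)) := by
  rw [Real.sin_add_two_pi, Complex.exp_eq_exp_iff_exists_int]
  exact ⟨m, by push_cast; ring⟩

/-- Bessel's integral in exponential form. -/
theorem integral_exp_eq_besselJ (m : ℤ) (x : ℝ) :
    ∫ τ in (0 : ℝ)..(2 * π), Complex.exp (Complex.I * ((m * τ - x * Real.sin τ : ℝ) : ℂ)) =
      2 * π * besselJ m x := by
  let g : ℝ → ℂ := fun τ => Complex.exp (Complex.I * ((m * τ - x * Real.sin τ : ℝ) : ℂ))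
  have hg : Continuous g := by fun_prop
  have hper : Function.Periodic g (2 * π) := exp_I_mul_int_mul_add_two_pi m x
  have h := hper.intervalIntegral_add_eq 0 (-π)
  rw [zero_add, show -π + 2 * π = π by ring,
    ← intervalIntegral.integral_add_adjacent_intervals (a := -π) (b := 0)
      (hg.intervalIntegrable _ _) (hg.intervalIntegrable _ _)] at h
  have hneg := intervalIntegral.integral_comp_neg (a := 0) (b := π) g
  rw [neg_zero] at hneg
  have hcos : ∀ τ, g (-τ) + g τ = ((2 * Real.cos (m * τ - x * Real.sin τ) : ℝ) : ℂ) := by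
    intro τ
    simp only [g, Real.sin_neg]
    rw [Complex.ofReal_mul, Complex.ofReal_cos, Complex.cos]
    push_cast
    rw [mul_div_cancel₀ _ two_ne_zero, add_comm]
    congr 2 <;> ring
  have hgneg : Continuous fun τ => g (-τ) := hg.comp continuous_neg
  rw [← hneg, ← intervalIntegral.integral_add (hgneg.intervalIntegrable _ _)
    (hg.intervalIntegrable _ _)] at h
  refine h.trans ?_
  simp only [hcos]
  rw [intervalIntegral.integral_ofReal, intervalIntegral.integral_const_mul, besselJ]
  push_cast
  have : (π : ℂ) ≠ 0 := by exact_mod_cast Real.pi_ne_zero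
  field_simp

/-- The angular part of the Fourier transform of `e^{imθ}` times a radial function. -/
theorem integral_exp_mul_exp_cos (m : ℤ) (x φ : ℝ) :
    ∫ θ in (0 : ℝ)..(2 * π), Complex.exp (Complex.I * m * θ) *
        Complex.exp (-Complex.I * ((x * Real.cos (θ - φ) : ℝ) : ℂ)) =
      2 * π * (-Complex.I) ^ m * Complex.exp (Complex.I * m * φ) * besselJ m x := by
  let g : ℝ → ℂ := fun τ => Complex.exp (Complex.I * ((m * τ - x * Real.sin τ : ℝ) : ℂ))
  have hI : (-Complex.I) ^ m = Complex.exp (-(Complex.I * m * (π / 2 : ℝ))) := by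
    rw [show -(Complex.I * m * (π / 2 : ℝ)) = m * (-π / 2 * Complex.I) by push_cast; ring,
      Complex.exp_int_mul, Complex.exp_neg_pi_div_two_mul_I]
  -- Substitute `τ = θ - φ + π / 2`, so that `cos (θ - φ) = sin τ`.
  have h1 : ∀ θ : ℝ, Complex.exp (Complex.I * m * θ) *
      Complex.exp (-Complex.I * ((x * Real.cos (θ - φ) : ℝ) : ℂ)) =
      (-Complex.I) ^ m * Complex.exp (Complex.I * m * φ) * g (θ + (π / 2 - φ)) := by
    intro θ
    simp only [g]
    rw [show θ + (π / 2 - φ) = θ - φ + π / 2 by ring, Real.sin_add_pi_div_two, hI,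
      ← Complex.exp_add, ← Complex.exp_add, ← Complex.exp_add]
    congr 1
    push_cast
    ring
  have hper : Function.Periodic g (2 * π) := exp_I_mul_int_mul_add_two_pi m x
  simp only [h1]
  rw [intervalIntegral.integral_const_mul, intervalIntegral.integral_comp_add_right, zero_add,
    add_comm (2 * π), hper.intervalIntegral_add_eq _ 0, zero_add, integral_exp_eq_besselJ]
  ring

/-- The inner product of `k` with the unit vector of angle `θ`, in polar coordinates of `k`. -/
theorem latticeNorm_mul_cos_sub (k : Fin 2 → ℤ) (θ : ℝ) :
    k 0 * Real.cos θ + k 1 * Real.sin θ = latticeNorm k * Real.cos (θ - latticeAngle k) := by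
  have hn : latticeNorm k = ‖(⟨(k 0 : ℝ), (k 1 : ℝ)⟩ : ℂ)‖ := by
    rw [latticeNorm, Complex.norm_def, Complex.normSq_mk]
    ring_nf
  have ha : latticeAngle k = Complex.arg ⟨(k 0 : ℝ), (k 1 : ℝ)⟩ -
      toIcoDiv Real.two_pi_pos 0 (Complex.arg ⟨(k 0 : ℝ), (k 1 : ℝ)⟩) * (2 * π) := by
    rw [latticeAngle, toIcoMod, zsmul_eq_mul]
  rw [Real.cos_sub, ha, Real.cos_sub_int_mul_two_pi, Real.sin_sub_int_mul_two_pi, mul_add, hn]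
  have h1 := Complex.norm_mul_cos_arg (⟨(k 0 : ℝ), (k 1 : ℝ)⟩ : ℂ)
  have h2 := Complex.norm_mul_sin_arg (⟨(k 0 : ℝ), (k 1 : ℝ)⟩ : ℂ)
  simp only at h1 h2
  linear_combination -(Real.cos θ) * h1 - Real.sin θ * h2

/-- The radial integral, by Lommel's formula; at the removable singularity of `besselQuot` it is
the energy identity instead. -/
theorem integral_besselJ_mul_besselJ {a : ℝ} (ha : 0 < a) {n : ℕ} (hn : 1 ≤ n) (m : ℤ) {x : ℝ}
    (hx : 0 ≤ x) :
    ∫ r in (0 : ℝ)..a, r * (besselJ m (radialFreq a n m * r) * besselJ m (x / a * r)) =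
      a ^ 2 * besselZero m n * deriv (besselJ m) (besselZero m n) * besselQuot n m x := by
  have hz := besselZero_pos m hn
  have hz0 := besselJ_besselZero m hn
  rw [radialFreq, besselQuot]
  split_ifs with h
  · subst h
    have h1 := integral_mul_besselJ_sq m hz.le
    rw [hz0] at h1
    have h2 := intervalIntegral.integral_comp_mul_left (a := 0) (b := a)
      (fun x => 2 * x * besselJ m x ^ 2) (c := besselZero m n / a) (by positivity)
    rw [mul_zero, div_mul_cancel₀ _ ha.ne', h1] at h2
    have h3 : ∀ r, r * (besselJ m (besselZero m n / a * r) * besselJ m (besselZero m n / a * r)) =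
        a / (2 * besselZero m n) * (2 * (besselZero m n / a * r) *
          besselJ m (besselZero m n / a * r) ^ 2) := by
      intro r
      field_simp
    simp only [h3]
    rw [intervalIntegral.integral_const_mul, h2, smul_eq_mul]
    field_simp
    ring
  · have h1 := lommel_integral m (besselZero m n / a) (x / a) ha.le
    rw [div_mul_cancel₀ _ ha.ne', div_mul_cancel₀ _ ha.ne', hz0, mul_zero, sub_zero] at h1
    have hne : x ^ 2 - besselZero m n ^ 2 ≠ 0 := by
      rw [sub_ne_zero]
      exact fun he => h ((sq_eq_sq₀ hx hz.le).1 he)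
    rw [show (x / a) ^ 2 - (besselZero m n / a) ^ 2 = (x ^ 2 - besselZero m n ^ 2) / a ^ 2 by
      ring, div_mul_eq_mul_div, div_eq_iff (by positivity)] at h1
    rw [mul_div_assoc', eq_div_iff hne]
    linear_combination h1

/-- The basis function `Ψ_{nm}` as a function on the plane, with `e^{iθ}` written as
`(x₀ + i x₁) / ‖x‖`. Its value at the origin, where the quotient is `0 / 0 = 0`, is immaterial. -/
def planeBasisFn (a : ℝ) (n : ℕ) (m : ℤ) (x : EuclideanSpace ℝ (Fin 2)) : ℂ :=
  ((1 / Real.sqrt (normConst a n m) * besselJ m (radialFreq a n m * ‖x‖) : ℝ) : ℂ) *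
    (((1 / Real.sqrt (2 * Real.pi) : ℝ) : ℂ) * ((x 0 + x 1 * Complex.I) / ‖x‖) ^ m)

theorem planeBasisFn_polarPoint (a : ℝ) (n : ℕ) (m : ℤ) {r : ℝ} (hr : 0 < r) (θ : ℝ) :
    planeBasisFn a n m (polarPoint r θ) = basisFn a n m r θ := by
  have h : (((polarPoint r θ) 0 : ℝ) + ((polarPoint r θ) 1 : ℝ) * Complex.I) / ((r : ℝ) : ℂ) =
      Complex.exp (θ * Complex.I) := by
    have : (r : ℂ) ≠ 0 := by exact_mod_cast hr.ne'
    simp only [polarPoint, Matrix.cons_val_zero, Matrix.cons_val_one]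
    rw [Complex.exp_mul_I]
    push_cast
    field_simp
  rw [planeBasisFn, basisFn, norm_polarPoint hr.le, h, ← Complex.exp_int_mul]
  congr 3
  ring

theorem measurable_planeBasisFn (a : ℝ) (n : ℕ) (m : ℤ) : Measurable (planeBasisFn a n m) := by
  have hJ := (continuous_besselJ m).measurable
  unfold planeBasisFn
  refine Measurable.mul ?_ (Measurable.mul measurable_const ?_)
  · exact Complex.measurable_ofReal.comp (measurable_const.mul (hJ.comp (by fun_prop)))
  · have h : Measurable fun x : EuclideanSpace ℝ (Fin 2) =>
      ((x 0 : ℂ) + x 1 * Complex.I) / (‖x‖ : ℂ) := by fun_prop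
    obtain ⟨k, rfl | rfl⟩ := m.eq_nat_or_neg
    · simp only [zpow_natCast]
      exact h.pow_const k
    · simp only [zpow_neg, zpow_natCast]
      exact (h.pow_const k).inv

theorem exists_norm_planeBasisFn_le (a : ℝ) (n : ℕ) (m : ℤ) :
    ∃ C, ∀ x ∈ Metric.closedBall (0 : EuclideanSpace ℝ (Fin 2)) a,
      ‖planeBasisFn a n m x‖ ≤ C := by
  have hJ := continuous_besselJ m
  obtain ⟨C, hC⟩ := (isCompact_closedBall (0 : EuclideanSpace ℝ (Fin 2))
    a).exists_bound_of_continuousOn (f := fun x =>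
      ((1 / Real.sqrt (normConst a n m) * besselJ m (radialFreq a n m * ‖x‖) : ℝ) : ℂ) *
      ((1 / Real.sqrt (2 * Real.pi) : ℝ) : ℂ)) (by fun_prop)
  refine ⟨C, fun x hx => ?_⟩
  rw [planeBasisFn, ← mul_assoc, norm_mul]
  refine (mul_le_of_le_one_right (norm_nonneg _) ?_).trans (hC x hx)
  have hn : ‖((x 0 : ℂ) + x 1 * Complex.I)‖ = ‖x‖ := by
    rw [Complex.norm_add_mul_I, EuclideanSpace.norm_eq, Fin.sum_univ_two]
    simp
  rw [norm_zpow, norm_div, hn, Complex.norm_real, norm_norm]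
  rcases eq_or_ne ‖x‖ 0 with h | h
  · rw [h, div_zero]
    rcases eq_or_ne m 0 with rfl | hm
    · simp
    · rw [zero_zpow m hm]; exact zero_le_one
  · rw [div_self h, one_zpow]

theorem memLp_planeBasisFn (a : ℝ) (n : ℕ) (m : ℤ) (p : ENNReal) :
    MemLp (planeBasisFn a n m) p (volume.restrict (Metric.closedBall 0 a)) := by
  obtain ⟨C, hC⟩ := exists_norm_planeBasisFn_le a n m
  exact MemLp.of_bound (measurable_planeBasisFn a n m).aestronglyMeasurable C
    ((ae_restrict_mem Metric.isClosed_closedBall.measurableSet).mono hC)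

/-- The Fourier coefficients of `Ψ_{nm}`, extended by zero to the square, are up to conjugation and
the area of the square the kernel coefficients. -/
theorem conj_diskFourier_planeBasisFn {a : ℝ} (ha : 0 < a) {n : ℕ} (hn : 1 ≤ n) (m : ℤ)
    (k : Fin 2 → ℤ) :
    conj (diskFourier a (planeBasisFn a n m) k) = 4 * a ^ 2 * kernelCoeff a n m k := by
  have hang : ∀ r ∈ Set.Ioc 0 a, ∫ θ in (0 : ℝ)..(2 * π),
      planeBasisFn a n m (polarPoint r θ) * Complex.exp (-Complex.I *
        ((π / a * r * (k 0 * Real.cos θ + k 1 * Real.sin θ) : ℝ) : ℂ)) * (r : ℂ) =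
      (((1 / √(normConst a n m) * (1 / √(2 * π)) : ℝ) : ℂ) * (2 * π * (-Complex.I) ^ m *
        Complex.exp (Complex.I * m * latticeAngle k))) * ((r * (besselJ m (radialFreq a n m * r) *
          besselJ m (π * latticeNorm k / a * r)) : ℝ) : ℂ) := by
    intro r hr
    have h : ∀ θ : ℝ, planeBasisFn a n m (polarPoint r θ) * Complex.exp (-Complex.I *
        ((π / a * r * (k 0 * Real.cos θ + k 1 * Real.sin θ) : ℝ) : ℂ)) * (r : ℂ) =
        ((1 / √(normConst a n m) * (1 / √(2 * π)) * (r * besselJ m (radialFreq a n m * r)) : ℝ) : ℂ)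
        * (Complex.exp (Complex.I * m * θ) * Complex.exp (-Complex.I *
          ((π * latticeNorm k / a * r * Real.cos (θ - latticeAngle k) : ℝ) : ℂ))) := by
      intro θ
      rw [planeBasisFn_polarPoint a n m hr.1, basisFn, latticeNorm_mul_cos_sub,
        show π / a * r * (latticeNorm k * Real.cos (θ - latticeAngle k)) =
          π * latticeNorm k / a * r * Real.cos (θ - latticeAngle k) by ring]
      push_cast
      ring
    simp only [h]
    rw [intervalIntegral.integral_const_mul, integral_exp_mul_exp_cos]
    push_cast
    ring
  have hN : √(normConst a n m) = a * |deriv (besselJ m) (besselZero m n)| / √2 := by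
    rw [normConst, show a ^ 2 / 2 * deriv (besselJ m) (besselZero m n) ^ 2 =
      (a * deriv (besselJ m) (besselZero m n)) ^ 2 / 2 by ring, Real.sqrt_div (sq_nonneg _),
      Real.sqrt_sq_eq_abs, abs_mul, abs_of_pos ha]
  have hconj : conj ((-Complex.I) ^ m) = Complex.I ^ m := by
    rw [map_zpow₀, map_neg, Complex.conj_I, neg_neg]
  have hexp : conj (Complex.exp (Complex.I * m * latticeAngle k)) =
      Complex.exp (-Complex.I * m * latticeAngle k) := by
    rw [← Complex.exp_conj, map_mul, map_mul, Complex.conj_I, Complex.conj_ofReal]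
    simp
  have hD := deriv_besselJ_besselZero_ne_zero m hn
  have hsign := I_zpow_mul_deriv_besselJ_besselZero m hn
  rw [diskFourier, intervalIntegral.integral_congr_ae (g := _)
      (Filter.Eventually.of_forall fun r hr => hang r (by rwa [Set.uIoc_of_le ha.le] at hr)),
    intervalIntegral.integral_const_mul,
    intervalIntegral.integral_ofReal, integral_besselJ_mul_besselJ ha hn m
      (by unfold latticeNorm; positivity), kernelCoeff, hN, radialFreq]
  simp only [map_mul, Complex.conj_ofReal, hconj, hexp, map_ofNat]
  -- The normalization constant cancels against `|J_m'(z_{nm})|`.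
  have hreal : 1 / (a * |deriv (besselJ m) (besselZero m n)| / √2) * (1 / √(2 * π)) * (2 * π) *
      a * |deriv (besselJ m) (besselZero m n)| = 2 * √π := by
    have h1 : |deriv (besselJ m) (besselZero m n)| ≠ 0 := abs_ne_zero.2 hD
    have h2 : √π ≠ 0 := (Real.sqrt_pos.2 Real.pi_pos).ne'
    rw [Real.sqrt_mul zero_le_two]
    field_simp
    exact (Real.sq_sqrt Real.pi_pos.le).symm
  have hrealC := congrArg (fun y : ℝ => (y : ℂ)) hreal
  have ha0 : (a : ℂ) ≠ 0 := by exact_mod_cast ha.ne'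
  set E := Complex.exp (-Complex.I * m * latticeAngle k)
  set D := deriv (besselJ m) (besselZero m n)
  set Q := besselQuot n m (π * latticeNorm k)
  simp only [Complex.ofReal_mul, Complex.ofReal_ofNat] at hrealC
  simp only [Complex.ofReal_mul, Complex.ofReal_pow, Complex.ofReal_div _ a]
  have h5 : (a : ℂ) ^ 2 * ((besselZero m n : ℂ) / a) = a * besselZero m n := by
    field_simp
  linear_combination (((1 / (a * |D| / √2) : ℝ) : ℂ) * ((1 / √(2 * π) : ℝ) : ℂ) *
      (2 * π) * a ^ 2 * besselZero m n * Q * E) * hsign +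
    ((-1) ^ n * Complex.I ^ m.natAbs * Q * E * a * besselZero m n) * hrealC -
    (2 * (√π : ℝ) * (-1) ^ n * Complex.I ^ m.natAbs * Q * E) * h5

/-! ### Expansion of the Fourier-Bessel coefficients -/

theorem memLp_zeroPad {a : ℝ} {f : EuclideanSpace ℝ (Fin 2) → ℂ} {p : ENNReal}
    (hf : MemLp f p (volume.restrict (Metric.closedBall 0 a))) :
    MemLp (zeroPad a f) p (volume.restrict (square a)) :=
  ((memLp_indicator_iff_restrict Metric.isClosed_closedBall.measurableSet).2 hf).restrict _

theorem integral_conj_zeroPad_mul_zeroPad (a : ℝ) (f g : EuclideanSpace ℝ (Fin 2) → ℂ) :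
    ∫ x in square a, conj (zeroPad a f x) * zeroPad a g x =
      ∫ x in Metric.closedBall 0 a, g x * conj (f x) := by
  have h : ∀ x, conj (zeroPad a f x) * zeroPad a g x =
      (Metric.closedBall 0 a).indicator (fun x => g x * conj (f x)) x := fun x => by
    by_cases hx : x ∈ Metric.closedBall 0 a
    · simp only [zeroPad, Set.indicator_of_mem hx, mul_comm]
    · simp only [zeroPad, Set.indicator_of_notMem hx, mul_zero]
  simp only [h]
  rw [setIntegral_indicator Metric.isClosed_closedBall.measurableSet,
    Set.inter_eq_self_of_subset_right (closedBall_subset_square a)]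

/-- The Fourier-Bessel coefficient is the inner product of the function with `Ψ_{nm}` in `L²` of the
disk. -/
theorem diskCoeff_eq_integral {a : ℝ} (ha : 0 < a) {f : EuclideanSpace ℝ (Fin 2) → ℂ}
    (hf : MemLp f 2 (volume.restrict (Metric.closedBall 0 a))) (n : ℕ) (m : ℤ) :
    diskCoeff a f n m = ∫ x in Metric.closedBall 0 a, f x * conj (planeBasisFn a n m x) := by
  refine Eq.trans ?_ (integral_closedBall_eq_polar ha.le
    (hf.integrable_mul (memLp_planeBasisFn a n m 2).star)).symm
  rw [diskCoeff]
  refine intervalIntegral.integral_congr_ae (Filter.Eventually.of_forall fun r hr => ?_)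
  rw [Set.uIoc_of_le ha.le] at hr
  simp only [Pi.mul_apply, Pi.star_apply, RCLike.star_def, planeBasisFn_polarPoint a n m hr.1]

/-- Parseval's identity on the square for the extensions by zero of `Ψ_{nm}` and `f`. -/
theorem hasSum_kernelCoeff_mul_diskFourier {a : ℝ} (ha : 0 < a)
    {f : EuclideanSpace ℝ (Fin 2) → ℂ}
    (hf : MemLp f 2 (volume.restrict (Metric.closedBall 0 a))) (m : ℤ) {n : ℕ} (hn : 1 ≤ n) :
    HasSum (fun k => kernelCoeff a n m k * diskFourier a f k) (diskCoeff a f n m) := by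
  have hΨ := memLp_planeBasisFn a n m 2
  have h := (hasSum_conj_squareFourier_mul ha (memLp_zeroPad hΨ) (memLp_zeroPad hf)).mul_left
    (4 * (a : ℂ) ^ 2)⁻¹
  have ha0 : (a : ℂ) ≠ 0 := by exact_mod_cast ha.ne'
  rw [integral_conj_zeroPad_mul_zeroPad, ← diskCoeff_eq_integral ha hf,
    inv_mul_cancel_left₀ (by simp [ha0])] at h
  refine h.congr_fun fun k => ?_
  rw [← diskFourier_eq_squareFourier ha (hΨ.integrable one_le_two),
    ← diskFourier_eq_squareFourier ha (hf.integrable one_le_two),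
    conj_diskFourier_planeBasisFn ha hn, mul_assoc, inv_mul_cancel_left₀ (by simp [ha0])]

end FourierBessel

end

theorem mainTheorem2 (a : ℝ) (ha : 0 < a) (ξ : EuclideanSpace ℝ (Fin 2) → ℂ)
    (hξ : MeasureTheory.MemLp ξ 2
      (MeasureTheory.volume.restrict (Metric.closedBall (0 : EuclideanSpace ℝ (Fin 2)) a)))
    (m : ℤ) (n : ℕ) (hn : 1 ≤ n) :
    (∀ k : Fin 2 → ℤ, FourierBessel.diskFourier a ξ k =
      FourierBessel.squareFourier a (FourierBessel.zeroPad a ξ) k) ∧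
    HasSum (fun k : Fin 2 → ℤ =>
      FourierBessel.kernelCoeff a n m k * FourierBessel.diskFourier a ξ k)
      (FourierBessel.diskCoeff a ξ n m) := by
  exact ⟨FourierBessel.diskFourier_eq_squareFourier ha (hξ.integrable one_le_two),
    FourierBessel.hasSum_kernelCoeff_mul_diskFourier ha hξ m hn⟩
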